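/- **The Refined Lecture Hall Theorem.** Let $n$ be a nonnegative integer. A lecture hall partition with $n$ parts is a sequence $\lambda=(\lambda_1,\dots,\lambda_n)$ of nonnegative integers with $$0\le \frac{\lambda_1}{1}\le\frac{\lambda_2}{2}\le\cdots\le\frac{\lambda_n}{n}.$$ For such a $\lambda$ put $|\lambda|=\sum_{i=1}^n\lambda_i$ and $\lceil\lambda\rceil=\left(\lceil\lambda_1/1\rceil,\lceil\lambda_2/2\rceil,\dots,\lceil\lambda_n/n\rceil\right)$, let $|\lceil\lambda\rceil|=\sum_{i=1}^n\lceil\lambda_i/i\rceil$, and let $o(\lceil\lambda\rceil)$ be the number of indices $i\in\{1,\dots,n\}$ for which $\lceil\lambda_i/i\rceil$ is odd. Then, as an identity of formal power series in $\mathbb{Z}[[x,u,v]]$, $$\sum_{\lambda}x^{|\lambda|}\,u^{|\lceil\lambda\rceil|}\,v^{o(\lceil\lambda\rceil)}=\frac{\prod_{i=1}^{n}(1+uvx^{i})}{\prod_{i=n+1}^{2n}(1-u^2x^{i})},$$ where the sum is over all lecture hall partitions $\lambda$ with $n$ parts. -/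

import Mathlib

open scoped MvPowerSeries.WithPiTopology

namespace LectureHall

/-- A lecture hall partition with `n` parts: nonnegative integers `lam_1, …, lam_n` with
`0 ≤ lam_1 / 1 ≤ lam_2 / 2 ≤ ⋯ ≤ lam_n / n`. The part `lam_j` is stored at the
index `j - 1 : Fin n`. Parts equal to zero are allowed. -/
def IsLectureHall {n : ℕ} (lam : Fin n → ℕ) : Prop :=
  Monotone fun i : Fin n => (lam i : ℚ) / ((i : ℚ) + 1)

/-- The sum of the entries of a sequence. -/
def size {n : ℕ} (a : Fin n → ℕ) : ℕ := ∑ i, a i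

/-- The sequence `(⌈lam_1 / 1⌉, ⌈lam_2 / 2⌉, …, ⌈lam_n / n⌉)`. -/
def ceilSeq {n : ℕ} (lam : Fin n → ℕ) : Fin n → ℕ :=
  fun i => ⌈(lam i : ℚ) / ((i : ℚ) + 1)⌉₊

/-- The number of (indices of) odd entries of a sequence. -/
def oddCount {n : ℕ} (a : Fin n → ℕ) : ℕ := (Finset.univ.filter fun i => Odd (a i)).card

/-- The ring `ℤ⟦x, u, v⟧` of formal power series in three variables; it carries the topology of
coefficientwise convergence, with `ℤ` discrete. -/
abbrev Series : Type := MvPowerSeries (Fin 3) ℤ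

/-- The variable `x`. -/
noncomputable def x : Series := MvPowerSeries.X 0

/-- The variable `u`. -/
noncomputable def u : Series := MvPowerSeries.X 1

/-- The variable `v`. -/
noncomputable def v : Series := MvPowerSeries.X 2

end LectureHall

/-!
Fix a threshold `t` and let `r` be the number of parts `λ_i` of a lecture hall partition with
`⌈λ_i / i⌉ ≤ t`. These are the first `r` parts, and the remaining `k = n - r` parts, the tail, all
have larger ceilings. The generating function of the possible tails depends only on `t`, `k` and
`r`, and it has a product formula. Raising the threshold to `t + 1` moves the `m` parts with ceiling
`t + 1` from the tail to the bounded part. Their contribution is a Gaussian binomial coefficient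
times a monomial, and the product formulas for `t` and `t + 1` are compatible by the
`q`-Chu–Vandermonde identity. Hence the sum over `r` of tails times bounded parts does not depend on
`t`. For `t = 0`, and multiplied by the denominator of the theorem, it is the product in the
numerator. As `t` grows, every nonempty tail is divisible by a growing power of `u`, so only the
bounded part with `r = n` survives, and it converges to the full generating function.
-/

open Finset hiding mem_antidiagonal
open Finset.HasAntidiagonal (mem_antidiagonal)

namespace LectureHall

section QBinomial

/-- The Gaussian binomial coefficient `[m + s choose m]` at `q`. It is indexed by `m` and `s`
instead of `m + s` and `m`, so that no subtraction occurs. -/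
def gaussBinom {R : Type*} [CommSemiring R] (q : R) : ℕ → ℕ → R
  | 0, _ => 1
  | _ + 1, 0 => 1
  | m + 1, s + 1 => q ^ (s + 1) * gaussBinom q m (s + 1) + gaussBinom q (m + 1) s

section CommSemiring

variable {R : Type*} [CommSemiring R] (q : R)

@[simp]
lemma gaussBinom_zero_left (s : ℕ) : gaussBinom q 0 s = 1 := by
  simp only [gaussBinom]

@[simp]
lemma gaussBinom_zero_right (m : ℕ) : gaussBinom q m 0 = 1 := by
  cases m <;> simp only [gaussBinom]

lemma gaussBinom_succ_succ (m s : ℕ) :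
    gaussBinom q (m + 1) (s + 1) =
      q ^ (s + 1) * gaussBinom q m (s + 1) + gaussBinom q (m + 1) s := by
  rw [gaussBinom]

lemma gaussBinom_mul_gaussBinom (l m s : ℕ) :
    gaussBinom q l (m + s) * gaussBinom q m s = gaussBinom q (l + m) s * gaussBinom q l m := by
  induction hN : l + m + s generalizing l m s with
  | zero =>
    obtain ⟨⟨rfl, rfl⟩, rfl⟩ : (l = 0 ∧ m = 0) ∧ s = 0 := by simpa using hN
    rfl
  | succ N ih =>
    obtain _ | l := l
    · simp
    obtain _ | m := m
    · simp
    obtain _ | s := s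
    · simp
    have h₁ := ih l (m + 1) (s + 1) (by omega)
    have h₂ := ih (l + 1) m (s + 1) (by omega)
    have h₃ := ih (l + 1) (m + 1) s (by omega)
    simp only [← add_assoc, add_right_comm _ 1] at h₁ h₂ h₃ ⊢
    calc gaussBinom q (l + 1) (m + s + 1 + 1) * gaussBinom q (m + 1) (s + 1)
        = q ^ (m + s + 1 + 1) * (gaussBinom q l (m + s + 1 + 1) * gaussBinom q (m + 1) (s + 1))
          + q ^ (s + 1) * (gaussBinom q (l + 1) (m + s + 1) * gaussBinom q m (s + 1))
          + gaussBinom q (l + 1) (m + s + 1) * gaussBinom q (m + 1) s := by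
          rw [gaussBinom_succ_succ q l (m + s + 1), add_mul]
          nth_rewrite 2 [gaussBinom_succ_succ q m s]
          ring
      _ = q ^ (m + s + 1 + 1) * (gaussBinom q (l + m + 1) (s + 1) * gaussBinom q l (m + 1))
          + q ^ (s + 1) * (gaussBinom q (l + m + 1) (s + 1) * gaussBinom q (l + 1) m)
          + gaussBinom q (l + m + 1 + 1) s * gaussBinom q (l + 1) (m + 1) := by rw [h₁, h₂, h₃]
      _ = gaussBinom q (l + m + 1 + 1) (s + 1) * gaussBinom q (l + 1) (m + 1) := by
          rw [gaussBinom_succ_succ q (l + m + 1) s, add_mul]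
          nth_rewrite 2 [gaussBinom_succ_succ q l m]
          ring

lemma sum_antidiagonal_succ_gaussBinom_mul (N : ℕ) (f : ℕ → ℕ → R) :
    ∑ p ∈ antidiagonal (N + 1), gaussBinom q p.1 p.2 * f p.1 p.2 =
      ∑ p ∈ antidiagonal N,
        gaussBinom q p.1 p.2 * (f p.1 (p.2 + 1) + q ^ p.2 * f (p.1 + 1) p.2) := by
  simp only [mul_add, sum_add_distrib]
  obtain _ | N := N
  · simp [Nat.sum_antidiagonal_succ]
  rw [Nat.sum_antidiagonal_succ, Nat.sum_antidiagonal_succ', Nat.sum_antidiagonal_succ,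
    Nat.sum_antidiagonal_succ' (n := N)]
  simp only [gaussBinom_succ_succ, add_mul, sum_add_distrib, gaussBinom_zero_left,
    gaussBinom_zero_right, pow_zero, one_mul, mul_left_comm (gaussBinom q _ _), ← mul_assoc]
  ac_rfl

/-- The finite product `∏_{j=1}^{n} (a + b q ^ j)`, a homogeneous `q`-shifted factorial. -/
def qProd (n : ℕ) (a b : R) : R := ∏ j ∈ range n, (a + b * q ^ (j + 1))

@[simp]
lemma qProd_zero (a b : R) : qProd q 0 a b = 1 := prod_range_zero _

lemma qProd_succ (n : ℕ) (a b : R) :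
    qProd q (n + 1) a b = qProd q n a b * (a + b * q ^ (n + 1)) :=
  prod_range_succ _ n

lemma qProd_add (m n : ℕ) (a b : R) :
    qProd q (m + n) a b = qProd q m a b * qProd q n a (b * q ^ m) := by
  simp only [qProd, prod_range_add, pow_add, mul_assoc]

lemma qProd_succ' (n : ℕ) (a b : R) :
    qProd q (n + 1) a b = (a + b * q) * qProd q n a (b * q) := by
  simp [add_comm n 1, qProd_add, qProd_succ]

lemma qProd_mul_left (n : ℕ) (c a b : R) :
    qProd q n (c * a) (c * b) = c ^ n * qProd q n a b := by
  simp only [qProd, mul_assoc, ← mul_add, prod_mul_distrib, prod_const, card_range]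

lemma prod_Icc_eq_qProd (m n : ℕ) (a b : R) :
    ∏ i ∈ Icc (m + 1) (m + n), (a + b * q ^ i) = qProd q n a (b * q ^ m) := by
  rw [← Ico_add_one_right_eq_Icc, prod_Ico_eq_prod_range, qProd]
  refine prod_congr (congrArg range (by omega)) fun j _ => ?_
  rw [mul_assoc, ← pow_add, add_assoc, add_comm 1 j]

lemma dvd_qProd {d : R} {n : ℕ} {a b : R} (ha : d ∣ a) (hb : d ∣ b) (hn : n ≠ 0) :
    d ∣ qProd q n a b :=
  (dvd_add ha (hb.mul_right _)).trans (dvd_prod_of_mem _ (mem_range.2 hn.bot_lt))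

end CommSemiring

/-- A form of the `q`-Chu–Vandermonde identity. -/
lemma qProd_eq_sum_antidiagonal {R : Type*} [CommRing R] (q a b z : R) (k : ℕ) :
    qProd q k a b = ∑ p ∈ antidiagonal k, gaussBinom q p.1 p.2 *
      (q ^ (p.1 + 1).choose 2 * qProd q p.1 b (z * a * q ^ p.2) *
        (a ^ p.2 * qProd q p.2 1 (-(z * q ^ k)))) := by
  induction k generalizing z with
  | zero => simp
  | succ k ih =>
    rw [sum_antidiagonal_succ_gaussBinom_mul q k fun l m =>
      q ^ (l + 1).choose 2 * qProd q l b (z * a * q ^ m) *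
        (a ^ m * qProd q m 1 (-(z * q ^ (k + 1)))), qProd_succ, ih (z * q), sum_mul]
    refine sum_congr rfl fun ⟨l, m⟩ hp => ?_
    obtain rfl : l + m = k := by simpa using hp
    have hb : z * q * a * q ^ m = z * a * q ^ m * q := by ring
    have hz : z * q * q ^ (l + m) = z * q ^ (l + m + 1) := by ring
    simp only [hb, hz, qProd_succ _ m, qProd_succ' _ l, Nat.choose_succ_succ' (l + 1) 1,
      Nat.choose_one_right]
    rw [show z * a * q ^ (m + 1) = z * a * q ^ m * q by ring]
    ring

end QBinomial

lemma sum_antidiagonal_assoc {A M : Type*} [AddMonoid A] [HasAntidiagonal A] [AddCommMonoid M]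
    (n : A) (f : A → A → A → M) :
    ∑ p ∈ antidiagonal n, ∑ q ∈ antidiagonal p.1, f q.1 q.2 p.2 =
      ∑ p ∈ antidiagonal n, ∑ q ∈ antidiagonal p.2, f p.1 q.1 q.2 := by
  simp only [sum_sigma']
  refine sum_nbij' (fun a => ⟨(a.2.1, a.2.2 + a.1.2), (a.2.2, a.1.2)⟩)
    (fun a => ⟨(a.1.1 + a.2.1, a.2.2), (a.1.1, a.2.1)⟩) ?_ ?_ ?_ ?_ ?_
  all_goals
    rintro ⟨⟨a, b⟩, c, d⟩
    simp only [mem_sigma, mem_antidiagonal]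
    rintro ⟨rfl, rfl⟩
    simp [add_assoc]

section Partitions

variable {n : ℕ} {lam : Fin n → ℕ}

lemma isLectureHall_iff :
    IsLectureHall lam ↔ ∀ i j : Fin n, i ≤ j → lam i * (j + 1) ≤ lam j * (i + 1) := by
  refine forall₃_congr fun i j _ => ?_
  rw [div_le_div_iff₀ (by positivity) (by positivity)]
  norm_cast

lemma isLectureHall_snoc {m : ℕ} :
    IsLectureHall (Fin.snoc lam m : Fin (n + 1) → ℕ) ↔
      IsLectureHall lam ∧ ∀ i, lam i * (n + 1) ≤ m * (i + 1) := by
  simp [isLectureHall_iff, Fin.forall_fin_succ', forall_and, Fin.le_last]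

lemma IsLectureHall.forall_mul_le_iff (h : IsLectureHall lam) {m : ℕ} :
    (∀ i, lam i * (n + 1) ≤ m * (i + 1)) ↔ ∀ i, lam i ≤ m * n / (n + 1) := by
  simp only [Nat.le_div_iff_mul_le n.succ_pos]
  refine ⟨fun hm i => (hm i).trans (Nat.mul_le_mul_left m i.isLt), fun hm i => ?_⟩
  obtain ⟨k, rfl⟩ := Nat.exists_eq_add_one_of_ne_zero i.pos.ne'
  have hlast := isLectureHall_iff.1 h i (Fin.last k) (Fin.le_last i)
  rw [Fin.val_last] at hlast
  refine Nat.le_of_mul_le_mul_left (c := k + 1) ?_ k.succ_pos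
  calc (k + 1) * (lam i * (k + 1 + 1)) = lam i * (k + 1) * (k + 1 + 1) := by ring
    _ ≤ lam (Fin.last k) * (i + 1) * (k + 1 + 1) := by gcongr
    _ = lam (Fin.last k) * (k + 1 + 1) * (i + 1) := by ring
    _ ≤ m * (k + 1) * (i + 1) := Nat.mul_le_mul_right _ (hm _)
    _ = (k + 1) * (m * (i + 1)) := by ring

open Classical in
/-- The lecture hall partitions with `n` parts, all of them at most `M`; since the last part of a
lecture hall partition is the largest, `M` is a bound on the last part. -/
noncomputable def boundedLectureHall (n M : ℕ) : Finset (Fin n → ℕ) :=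
  {lam ∈ Fintype.piFinset fun _ => range (M + 1) | IsLectureHall lam}

lemma mem_boundedLectureHall {M : ℕ} :
    lam ∈ boundedLectureHall n M ↔ IsLectureHall lam ∧ ∀ i, lam i ≤ M := by
  simp only [boundedLectureHall, mem_filter, Fintype.mem_piFinset, mem_range, Nat.lt_succ_iff,
    and_comm]

lemma snoc_mem_boundedLectureHall {m M : ℕ} :
    (Fin.snoc lam m : Fin (n + 1) → ℕ) ∈ boundedLectureHall (n + 1) M ↔
      lam ∈ boundedLectureHall n (m * n / (n + 1)) ∧ m ≤ M := by
  simp only [mem_boundedLectureHall, isLectureHall_snoc, Fin.forall_fin_succ', Fin.snoc_castSucc,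
    Fin.snoc_last]
  constructor
  · rintro ⟨⟨h, hm⟩, -, hM⟩
    exact ⟨⟨h, h.forall_mul_le_iff.1 hm⟩, hM⟩
  · rintro ⟨⟨h, hm⟩, hM⟩
    refine ⟨⟨h, h.forall_mul_le_iff.2 hm⟩, fun i => ?_, hM⟩
    calc lam i ≤ m * n / (n + 1) := hm i
      _ ≤ m := Nat.div_le_of_le_mul (by nlinarith)
      _ ≤ M := hM

lemma boundedLectureHall_mono (n : ℕ) : Monotone (boundedLectureHall n) := fun _ _ hM _ h =>
  mem_boundedLectureHall.2
    ⟨(mem_boundedLectureHall.1 h).1, fun i => ((mem_boundedLectureHall.1 h).2 i).trans hM⟩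

lemma boundedLectureHall_succ_sdiff (n M : ℕ) :
    boundedLectureHall (n + 1) (M + 1) \ boundedLectureHall (n + 1) M =
      (boundedLectureHall n ((M + 1) * n / (n + 1))).image fun lam => Fin.snoc lam (M + 1) := by
  ext lam
  rw [← Fin.snoc_init_self lam]
  simp only [mem_sdiff, mem_image, snoc_mem_boundedLectureHall, Fin.snoc_inj]
  constructor
  · rintro ⟨⟨h, hle⟩, hnot⟩
    have hlast : lam (Fin.last n) = M + 1 :=
      le_antisymm hle (Nat.lt_of_not_le fun hle' => hnot ⟨h, hle'⟩)
    exact ⟨Fin.init lam, hlast ▸ h, rfl, hlast.symm⟩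
  · rintro ⟨lam', h, rfl, hlast⟩
    rw [← hlast]
    exact ⟨⟨h, le_rfl⟩, fun h' => absurd h'.2 (by omega)⟩

lemma boundedLectureHall_zero (n : ℕ) : boundedLectureHall n 0 = {0} := by
  ext lam
  simp only [mem_boundedLectureHall, Nat.le_zero, mem_singleton, funext_iff, Pi.zero_apply,
    and_iff_right_iff_imp]
  intro h
  simp [isLectureHall_iff, h]

lemma mul_div_add_one_eq {N : ℕ} (t : ℕ) (hN : N ≤ n) :
    ((n + 1) * t + N + 1) * n / (n + 1) = n * t + N := by
  refine Nat.div_eq_of_lt_le ?_ ?_ <;> nlinarith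

lemma ceil_div_add_one_eq {N : ℕ} (t : ℕ) (hN : N ≤ n) :
    ⌈(((n + 1) * t + N + 1 : ℕ) : ℚ) / ((n : ℚ) + 1)⌉₊ = t + 1 := by
  rw [Nat.ceil_eq_iff (by omega), lt_div_iff₀ (by positivity), div_le_iff₀ (by positivity)]
  norm_cast
  rw [Nat.add_sub_cancel]
  constructor <;> nlinarith

end Partitions

section Sums

variable {R : Type*}

section CommSemiring

variable [CommSemiring R] (q : R) (w : ℕ → R)

/-- The weight of a sequence `lam` which counts its size by powers of `q` and gives the weight
`w c` to every entry `c` of `⌈lam⌉`. -/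
def weight {n : ℕ} (lam : Fin n → ℕ) : R := ∏ i, q ^ lam i * w (ceilSeq lam i)

lemma weight_snoc {n : ℕ} (lam : Fin n → ℕ) (m : ℕ) :
    weight q w (Fin.snoc lam m : Fin (n + 1) → ℕ) =
      q ^ m * w ⌈(m : ℚ) / ((n : ℚ) + 1)⌉₊ * weight q w lam := by
  simp [weight, Fin.prod_univ_castSucc, ceilSeq, mul_comm]

/-- The generating function of the lecture hall partitions with `n` parts, all at most `M`. -/
noncomputable def boundedSum (n M : ℕ) : R := ∑ lam ∈ boundedLectureHall n M, weight q w lam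

lemma boundedSum_zero_right (hw : w 0 = 1) (n : ℕ) : boundedSum q w n 0 = 1 := by
  simp [boundedSum, boundedLectureHall_zero, weight, ceilSeq, hw]

lemma boundedSum_succ_succ (n M : ℕ) :
    boundedSum q w (n + 1) (M + 1) = boundedSum q w (n + 1) M +
      q ^ (M + 1) * w ⌈((M + 1 : ℕ) : ℚ) / ((n : ℚ) + 1)⌉₊ *
        boundedSum q w n ((M + 1) * n / (n + 1)) := by
  have hinj : Set.InjOn (fun lam : Fin n → ℕ => (Fin.snoc lam (M + 1) : Fin (n + 1) → ℕ))
      (boundedLectureHall n ((M + 1) * n / (n + 1))) :=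
    fun _ _ _ _ h => (Fin.snoc_inj.1 h).1
  rw [boundedSum, ← sum_sdiff (boundedLectureHall_mono (n + 1) M.le_succ),
    boundedLectureHall_succ_sdiff, sum_image hinj, add_comm]
  simp only [boundedSum, weight_snoc, mul_sum]

/-- The least size of `m` consecutive parts with ceiling `t + 1` which follow `p` parts of smaller
ceiling: such parts are at least `t * (p + j) + j` for `j = 1, …, m`. -/
def blockExponent (t m p : ℕ) : ℕ := t * (m * p) + (t + 1) * (m + 1).choose 2

lemma blockExponent_succ (t m p : ℕ) :
    blockExponent t (m + 1) p = blockExponent t m p + (t * (m + 1 + p) + (m + 1)) := by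
  simp only [blockExponent, Nat.choose_succ_succ' (m + 1) 1, Nat.choose_one_right]
  ring

lemma choose_two_add (l m : ℕ) :
    (l + m + 1).choose 2 = (l + 1).choose 2 + (m + 1).choose 2 + l * m := by
  induction m with
  | zero => simp
  | succ m ih =>
    rw [← add_assoc, Nat.choose_succ_succ' (l + m + 1) 1, Nat.choose_succ_succ' (m + 1) 1, ih]
    simp only [Nat.choose_one_right]
    ring

lemma blockExponent_add (t l m p : ℕ) :
    blockExponent t (l + m) p + (l * p + (l + 1).choose 2) =
      blockExponent (t + 1) l (m + p) + blockExponent t m p := by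
  simp only [blockExponent, choose_two_add]
  ring

/-- The sum classifies partitions by the number `p.1` of parts with ceiling `t + 1`. Writing the
number of parts as `N + d` expresses that the bound exceeds `(N + d) * t` by at most `N + d`. -/
lemma boundedSum_eq_sum_antidiagonal (t N d : ℕ) :
    boundedSum q w (N + d) ((N + d) * t + N) = ∑ p ∈ antidiagonal N, gaussBinom q p.1 p.2 *
      (w (t + 1) ^ p.1 * q ^ blockExponent t p.1 (p.2 + d) *
        boundedSum q w (p.2 + d) ((p.2 + d) * t)) := by
  induction N generalizing d with
  | zero => simp [blockExponent]
  | succ N ih =>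
    have hlast := boundedSum_succ_succ q w (N + d) ((N + d + 1) * t + N)
    rw [mul_div_add_one_eq t (N.le_add_right d), ceil_div_add_one_eq t (N.le_add_right d), ih d]
      at hlast
    rw [sum_antidiagonal_succ_gaussBinom_mul q N fun m s =>
      w (t + 1) ^ m * q ^ blockExponent t m (s + d) * boundedSum q w (s + d) ((s + d) * t)]
    simp only [mul_add, sum_add_distrib, add_right_comm _ 1 d]
    rw [← add_assoc, hlast, add_assoc N d 1, ih (d + 1), mul_sum]
    congr 1
    refine sum_congr rfl fun ⟨m, s⟩ hp => ?_
    obtain rfl : m + s = N := by simpa using hp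
    simp only [blockExponent_succ]
    ring

end CommSemiring

section CommRing

variable [CommRing R] (q z : R) (w : ℕ → R)

/-- The generating function of the tails of lecture hall partitions, i.e. of the last `k` of
`k + r` parts, when these and no others have a ceiling greater than `t`. It is multiplied by the
denominator `∏_{i = k + r + 1}^{2 (k + r)} (1 - z q ^ i)`, which makes it a polynomial. -/
def tailNumerator (t k r : ℕ) : R :=
  gaussBinom q k r * (q ^ blockExponent t k r *
    (qProd q k (w (t + 1)) (w (t + 2) * q ^ r) * qProd q r 1 (-(z * q ^ (k + r)))))

variable {z w}

lemma tailNumerator_eq_sum_antidiagonal (hw : ∀ c, w (c + 2) = z * w c) (t k r : ℕ) :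
    tailNumerator q z w t k r = ∑ p ∈ antidiagonal k, tailNumerator q z w (t + 1) p.1 (p.2 + r) *
      (gaussBinom q p.2 r * (w (t + 1) ^ p.2 * q ^ blockExponent t p.2 r)) := by
  rw [tailNumerator, qProd_eq_sum_antidiagonal q _ _ (z * q ^ (2 * r)), sum_mul, mul_sum, mul_sum]
  refine sum_congr rfl fun ⟨l, m⟩ hp => ?_
  obtain rfl : l + m = k := by simpa using hp
  have hdenominator : qProd q (m + r) 1 (-(z * q ^ (l + (m + r)))) =
      qProd q r 1 (-(z * q ^ (l + m + r))) *
        qProd q m 1 (-(z * q ^ (2 * r) * q ^ (l + m))) := by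
    rw [add_comm m r, qProd_add]
    ring_nf
  have hnumerator : qProd q l (w (t + 2) * q ^ r) (z * q ^ (2 * r) * w (t + 1) * q ^ m) =
      q ^ (l * r) * qProd q l (w (t + 1 + 1)) (w (t + 1 + 2) * q ^ (m + r)) := by
    rw [mul_comm l, pow_mul q r l, ← qProd_mul_left, hw (t + 1)]
    congr 1 <;> ring
  have hexponent : q ^ blockExponent t (l + m) r * (q ^ (l * r) * q ^ (l + 1).choose 2) =
      q ^ blockExponent (t + 1) l (m + r) * q ^ blockExponent t m r := by
    simp only [← pow_add, blockExponent_add]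
  simp only [tailNumerator, hdenominator, hnumerator]
  have hbinom := gaussBinom_mul_gaussBinom q l m r
  linear_combination w (t + 1) ^ m * qProd q l (w (t + 1 + 1)) (w (t + 1 + 2) * q ^ (m + r)) *
    qProd q r 1 (-(z * q ^ (l + m + r))) * qProd q m 1 (-(z * q ^ (2 * r) * q ^ (l + m))) *
    (gaussBinom q (l + m) r * gaussBinom q l m * hexponent -
      q ^ blockExponent (t + 1) l (m + r) * q ^ blockExponent t m r * hbinom)

/-- Up to the denominator, the sum splits all lecture hall partitions with `n` parts according to
the number `p.2` of parts with ceiling at most `t`, so it should not depend on `t`. -/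
lemma sum_antidiagonal_tailNumerator_mul_boundedSum (hw₀ : w 0 = 1)
    (hw : ∀ c, w (c + 2) = z * w c) (n t : ℕ) :
    ∑ p ∈ antidiagonal n, tailNumerator q z w t p.1 p.2 * boundedSum q w p.2 (p.2 * t) =
      qProd q n 1 (w 1) := by
  induction t with
  | zero =>
    rw [qProd_eq_sum_antidiagonal q 1 (w 1) z]
    refine sum_congr rfl fun ⟨k, r⟩ hp => ?_
    obtain rfl : k + r = n := by simpa using hp
    simp only [tailNumerator, mul_zero, boundedSum_zero_right q w hw₀, blockExponent, hw 0, hw₀]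
    simp [mul_assoc]
  | succ t ih =>
    have hB (N : ℕ) := boundedSum_eq_sum_antidiagonal q w t N 0
    simp only [add_zero, ← mul_add_one] at hB
    simp only [← ih, tailNumerator_eq_sum_antidiagonal q hw t, hB, sum_mul, mul_sum]
    rw [sum_antidiagonal_assoc n fun l m r => tailNumerator q z w (t + 1) l (m + r) *
      (gaussBinom q m r * (w (t + 1) ^ m * q ^ blockExponent t m r)) * boundedSum q w r (r * t)]
    refine sum_congr rfl fun p _ => sum_congr rfl fun p' hp' => ?_
    rw [mem_antidiagonal.1 hp']
    ring

lemma dvd_tailNumerator {d : R} {t k : ℕ} (h₁ : d ∣ w (t + 1)) (h₂ : d ∣ w (t + 2)) (hk : k ≠ 0)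
    (r : ℕ) : d ∣ tailNumerator q z w t k r :=
  (((dvd_qProd q h₁ (h₂.mul_right _) hk).mul_right _).mul_left _).mul_left _

lemma dvd_qProd_mul_boundedSum_sub (hw₀ : w 0 = 1) (hw : ∀ c, w (c + 2) = z * w c) {d : R}
    {t : ℕ} (h₁ : d ∣ w (t + 1)) (h₂ : d ∣ w (t + 2)) (n : ℕ) :
    d ∣ qProd q n 1 (-(z * q ^ n)) * boundedSum q w n (n * t) - qProd q n 1 (w 1) := by
  rw [← sum_antidiagonal_tailNumerator_mul_boundedSum q hw₀ hw n t,
    ← add_sum_erase _ _ (show (0, n) ∈ antidiagonal n by simp)]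
  have htail : d ∣ ∑ p ∈ (antidiagonal n).erase (0, n),
      tailNumerator q z w t p.1 p.2 * boundedSum q w p.2 (p.2 * t) := by
    refine dvd_sum fun ⟨k, r⟩ hp => (dvd_tailNumerator q h₁ h₂ ?_ r).mul_right _
    rintro rfl
    simp_all
  rw [← dvd_neg] at htail
  convert htail using 1
  simp [tailNumerator, blockExponent]

end CommRing

end Sums

/-- The weight `u ^ c * v ^ [c odd]` of a ceiling `c`. -/
noncomputable def ceilWeight (c : ℕ) : Series := u ^ c * v ^ (c % 2)

lemma ceilWeight_add_two (c : ℕ) : ceilWeight (c + 2) = u ^ 2 * ceilWeight c := by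
  rw [ceilWeight, ceilWeight, Nat.add_mod_right, pow_add, mul_comm (u ^ c), mul_assoc]

lemma u_pow_dvd_ceilWeight {b c : ℕ} (h : b ≤ c) : u ^ b ∣ ceilWeight c :=
  (pow_dvd_pow u h).mul_right _

lemma oddCount_eq_sum {n : ℕ} (a : Fin n → ℕ) : oddCount a = ∑ i, a i % 2 := by
  rw [oddCount, card_filter]
  refine sum_congr rfl fun i _ => ?_
  split_ifs with hi
  · exact (Nat.odd_iff.1 hi).symm
  · exact (Nat.not_odd_iff.1 hi).symm

lemma weight_ceilWeight {n : ℕ} (lam : Fin n → ℕ) :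
    weight x ceilWeight lam =
      x ^ size lam * u ^ size (ceilSeq lam) * v ^ oddCount (ceilSeq lam) := by
  simp only [weight, ceilWeight, size, oddCount_eq_sum, prod_mul_distrib, prod_pow_eq_pow_sum,
    mul_assoc]

lemma u_pow_dvd_weight {n t : ℕ} {lam : Fin n → ℕ} (h : IsLectureHall lam)
    (hlam : lam ∉ boundedLectureHall n (n * t)) : u ^ (t + 1) ∣ weight x ceilWeight lam := by
  obtain ⟨i, hi⟩ : ∃ i, n * t < lam i := by simpa [mem_boundedLectureHall, h] using hlam
  have hceil : t < ceilSeq lam i := by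
    rw [ceilSeq, Nat.lt_ceil, lt_div_iff₀ (by positivity)]
    norm_cast
    calc t * (i + 1) ≤ t * n := Nat.mul_le_mul_left t i.isLt
      _ = n * t := mul_comm t n
      _ < lam i := hi
  exact ((u_pow_dvd_ceilWeight hceil).mul_left _).trans (dvd_prod_of_mem _ (mem_univ i))

lemma hasSum_weight_of_forall_dvd {n : ℕ} {F : Series}
    (h : ∀ t, u ^ (t + 1) ∣ boundedSum x ceilWeight n (n * t) - F) :
    HasSum (fun lam : {lam : Fin n → ℕ // IsLectureHall lam} => weight x ceilWeight lam.1) F := by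
  classical
  have coeff_eq_zero {f : Series} {d : Fin 3 →₀ ℕ} (hf : u ^ (d 1 + 1) ∣ f) :
      MvPowerSeries.coeff d f = 0 :=
    MvPowerSeries.X_pow_dvd_iff.1 hf d (d 1).lt_succ_self
  rw [MvPowerSeries.WithPiTopology.hasSum_iff_hasSum_coeff]
  intro d
  have hF := coeff_eq_zero (h (d 1))
  rw [map_sub, sub_eq_zero, boundedSum, map_sum] at hF
  rw [← hF, ← sum_subtype_of_mem (p := IsLectureHall) _
    fun lam hlam => (mem_boundedLectureHall.1 hlam).1]
  exact hasSum_sum_of_ne_finset_zero fun lam hlam =>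
    coeff_eq_zero (u_pow_dvd_weight lam.2 fun hmem => hlam (mem_subtype.2 hmem))

end LectureHall

/-- The sum converges in `ℤ⟦x, u, v⟧`, unconditionally and coefficientwise, and its value is the
stated quotient. The denominator has constant coefficient `1`, and `invOfUnit _ 1` is its inverse. -/
theorem theoremt (n : ℕ) :
    HasSum
      (fun lam : {lam : Fin n → ℕ // LectureHall.IsLectureHall lam} =>
        LectureHall.x ^ LectureHall.size lam.1
          * LectureHall.u ^ LectureHall.size (LectureHall.ceilSeq lam.1)
          * LectureHall.v ^ LectureHall.oddCount (LectureHall.ceilSeq lam.1))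
      ((∏ i ∈ Finset.Icc 1 n, (1 + LectureHall.u * LectureHall.v * LectureHall.x ^ i))
        * MvPowerSeries.invOfUnit
            (∏ i ∈ Finset.Icc (n + 1) (2 * n), (1 - LectureHall.u ^ 2 * LectureHall.x ^ i)) 1) := by
  open LectureHall in
  simp only [← weight_ceilWeight]
  set Q := ∏ i ∈ Icc (n + 1) (2 * n), (1 - u ^ 2 * x ^ i) with hQ
  have hinv : Q * MvPowerSeries.invOfUnit Q 1 = 1 :=
    MvPowerSeries.mul_invOfUnit Q 1 (by simp [hQ, u])
  have hnumerator : qProd x n 1 (ceilWeight 1) = ∏ i ∈ Icc 1 n, (1 + u * v * x ^ i) := by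
    simpa [ceilWeight] using (prod_Icc_eq_qProd x 0 n 1 (u * v)).symm
  have hdenominator : qProd x n 1 (-(u ^ 2 * x ^ n)) = Q := by
    simpa [hQ, two_mul, sub_eq_add_neg] using (prod_Icc_eq_qProd x n n 1 (-u ^ 2)).symm
  refine hasSum_weight_of_forall_dvd fun t => ?_
  have hdvd := dvd_qProd_mul_boundedSum_sub x (by simp [ceilWeight]) ceilWeight_add_two
    (u_pow_dvd_ceilWeight (le_refl (t + 1))) (u_pow_dvd_ceilWeight (t + 1).le_succ) n
  rw [hnumerator, hdenominator] at hdvd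
  convert hdvd.mul_right (MvPowerSeries.invOfUnit Q 1) using 1
  linear_combination (- boundedSum x ceilWeight n (n * t)) * hinv
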